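/- A tuple generating dependency (TGD) is a sentence $\forall\bar x\,(\Phi(\bar x)\Rightarrow\exists\bar y\;Q(\bar y,\bar x'))$ over a relational signature, where $\Phi$ is a (possibly empty) finite conjunction of relational atoms containing exactly the variables $\bar x$, where $Q$ is a relation symbol and where $\bar x'\subseteq\bar x$. The tuple $\bar y$ may be empty, and the variables of the head may occur there in any order and with repetitions. A TGD is joinless if each variable that occurs in its body $\Phi$ occurs there only once (the body may have several atoms). Joinless Logic consists of all finite sets of joinless TGDs. For a set $\mathcal T$ of TGDs and a database instance $D$ (a set of facts over constants), let $\mathrm{Chase}^0(\mathcal T,D)=D$; let $\mathrm{Chase}^{i+1}(\mathcal T,D)$ arise from $\mathrm{Chase}^i(\mathcal T,D)$ as follows: for each rule in $\mathcal T$ and each valuation of its variables $\bar x$ for which in $\mathrm{Chase}^i(\mathcal T,D)$ the body is true and the head $\exists\bar y\;Q(\bar y,\bar x')$ is false, add the fact $Q(\bar y,\bar x')$, with fresh elements (one tuple of them for each rule and each valuation of $\bar x'$) as the values of $\bar y$; and let $\mathrm{Chase}(\mathcal T,D)=\bigcup_i\mathrm{Chase}^i(\mathcal T,D)$. **Theorem.**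 Joinless Logic has the finite controllability property. That is, for every finite set $\mathcal T$ of joinless TGDs, every finite database instance $D$ and every Boolean union of conjunctive queries $\Psi$ with $\mathrm{Chase}(\mathcal T,D)\not\models\Psi$, there is a finite structure $M$ that contains $D$ (distinct elements of $D$ remaining distinct), is a model of $\mathcal T$, and falsifies $\Psi$. -/

import Mathlib

universe u v w

namespace Datalog

/-- A relational signature: relation symbols with (possibly zero) arities. -/
structure Signature where
  Rel : Type u
  arity : Rel → ℕ

/-- An atom over `A`. If `A` is the set of variables this is an atomic formula, and if `A` is the
domain of a structure this is a fact. -/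
structure Atom (σ : Signature.{u}) (A : Type v) where
  rel : σ.Rel
  args : Fin (σ.arity rel) → A

namespace Atom

variable {σ : Signature.{u}} {A : Type v} {B : Type w}

/-- Replace the arguments of an atom along a map. -/
def map (h : A → B) (a : Atom σ A) : Atom σ B :=
  ⟨a.rel, fun i => h (a.args i)⟩

/-- The arguments of an atom, listed with repetitions. -/
def argList (a : Atom σ A) : List A :=
  List.ofFn a.args

end Atom

/-- A relational structure with domain `A`, given by the set of the facts that hold in it. -/
abbrev Struct (σ : Signature.{u}) (A : Type v) := Set (Atom σ A)

/-- The elements that occur in the facts. -/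
def Struct.adom {σ : Signature.{u}} {A : Type v} (S : Struct σ A) : Set A :=
  {a | ∃ f ∈ S, a ∈ f.argList}

/-- Variables. -/
abbrev Var := ℕ

/-- A Boolean conjunctive query: a finite conjunction of atoms, with all its variables
existentially quantified. -/
abbrev CQ (σ : Signature.{u}) := List (Atom σ Var)

/-- A Boolean union of conjunctive queries. -/
abbrev UCQ (σ : Signature.{u}) := List (CQ σ)

/-- The valuation `τ` makes every atom of the conjunction `φ` true in `S`. -/
def Struct.HoldsAt {σ : Signature.{u}} {A : Type v} (S : Struct σ A) (φ : CQ σ)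
    (τ : Var → A) : Prop :=
  ∀ a ∈ φ, a.map τ ∈ S

/-- `S ⊨ Ψ` for a Boolean union of conjunctive queries `Ψ`. -/
def Struct.SatUCQ {σ : Signature.{u}} {A : Type v} (S : Struct σ A) (Ψ : UCQ σ) : Prop :=
  ∃ φ ∈ Ψ, ∃ τ : Var → A, S.HoldsAt φ τ

/-- A tuple generating dependency `body ⇒ ∃ ȳ head`, where the head is a single atom. The variables
of the body are universally quantified, and `ȳ` are the variables of the head that do not occur in
the body. -/
structure TGD (σ : Signature.{u}) where
  body : List (Atom σ Var)
  head : Atom σ Var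

namespace TGD

variable {σ : Signature.{u}}

/-- All occurrences of variables in the body, listed with repetitions. -/
def bodyVars (r : TGD σ) : List Var :=
  r.body.flatMap Atom.argList

/-- The variables shared by the body and the head. -/
def frontier (r : TGD σ) : Set Var :=
  {x | x ∈ r.bodyVars ∧ x ∈ r.head.argList}

/-- Each variable in the body occurs there only once. -/
def IsJoinless (r : TGD σ) : Prop :=
  r.bodyVars.Nodup

/-- The formula `∃ ȳ head` is true in `S`, where the universally quantified variables have their
values under `τ`. -/
def HeadHoldsAt {A : Type v} (r : TGD σ) (S : Struct σ A) (τ : Var → A) : Prop :=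
  ∃ τ' : Var → A, (∀ x ∈ r.bodyVars, τ' x = τ x) ∧ r.head.map τ' ∈ S

end TGD

/-- `S ⊨ T`. -/
def Struct.SatTGDs {σ : Signature.{u}} {A : Type v} (S : Struct σ A) (T : Set (TGD σ)) : Prop :=
  ∀ r ∈ T, ∀ τ : Var → A, S.HoldsAt r.body τ → r.HeadHoldsAt S τ

/-- The possible elements of the chase: the constants from `C`, and for each rule `r`, each
existential variable `y` of `r` and each valuation `f` of the frontier of `r`, a labelled null, which
serves as the free witness for `y`. -/
inductive ChaseElem (σ : Signature.{u}) (C : Type v) : Type (max u v)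
  | const (c : C) : ChaseElem σ C
  | null (r : TGD σ) (y : Var) (f : r.frontier → ChaseElem σ C) : ChaseElem σ C

section Chase

variable {σ : Signature.{u}} {C : Type v}

open Classical in
/-- Keep the values of the body variables, and give each other variable its free witness. -/
noncomputable def TGD.witness (r : TGD σ) (τ : Var → ChaseElem σ C) (x : Var) : ChaseElem σ C :=
  if x ∈ r.bodyVars then τ x else ChaseElem.null r x (fun z => τ z)

/-- One (parallel) step of the chase: whenever the body of a rule is satisfied and its head is not,
add the head with free witnesses. -/
def chaseStep (T : Set (TGD σ)) (S : Struct σ (ChaseElem σ C)) : Struct σ (ChaseElem σ C) :=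
  S ∪ {f | ∃ r ∈ T, ∃ τ : Var → ChaseElem σ C,
    S.HoldsAt r.body τ ∧ ¬ r.HeadHoldsAt S τ ∧ f = r.head.map (r.witness τ)}

/-- The `i`-th stage of the chase. -/
def chaseStage (T : Set (TGD σ)) (D : Struct σ C) : ℕ → Struct σ (ChaseElem σ C)
  | 0 => Atom.map ChaseElem.const '' D
  | i + 1 => chaseStep T (chaseStage T D i)

/-- `Chase(T, D)`. -/
def chase (T : Set (TGD σ)) (D : Struct σ C) : Struct σ (ChaseElem σ C) :=
  ⋃ i, chaseStage T D i

end Chase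

/-- The finite controllability property of a set `T` of TGDs: for every finite database instance `D`
and every UCQ `Ψ` that is false in `Chase(T, D)` there is a finite structure that contains `D` (up to
renaming its elements injectively), is a model of `T`, and falsifies `Ψ`. -/
def FinitelyControllable {σ : Signature.{u}} (T : Set (TGD σ)) : Prop :=
  ∀ (C : Type v) [Nonempty C] (D : Struct σ C), D.Finite →
    ∀ Ψ : UCQ σ, ¬ (chase T D).SatUCQ Ψ →
      ∃ (A : Type) (_ : Finite A) (M : Struct σ A) (h : C → A),
        Set.InjOn h D.adom ∧ (∀ f ∈ D, f.map h ∈ M) ∧ M.SatTGDs T ∧ ¬ M.SatUCQ Ψ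

/-- Joinless Logic: the finite sets of joinless TGDs. -/
def JoinlessLogic (σ : Signature.{u}) : Set (Set (TGD σ)) :=
  {T | T.Finite ∧ ∀ r ∈ T, r.IsJoinless}

end Datalog

namespace Datalog

/-! ### Lifting the atoms of a joinless body independently -/

namespace Atom

variable {σ : Signature.{u}} {A : Type*} {B : Type*} {E : Type*}

/-! The finite model is a quotient of the chase. Body atoms of a joinless rule share no variables
and repeat none, so a body match in a homomorphic image lifts atom by atom; hence every image of the
chase is a model (`Struct.SatTGDs.image`). It remains to find a finite quotient that creates no
match of `Ψ`.

A null is a term over its frontier values, its parents. Nulls are coloured so that no colour recurs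
among the ancestors up to distance `K`. Terms are cut at depth `n`, with the nearby colours recorded
at the cut; this leaves finitely many classes (`finite_trunc_image`). Both `K` and `n` are the
number of variables of `Ψ`.

A match in the quotient is a list of chase facts whose slots, labelled by query variables, agree
only up to truncation. `exists_sat` makes the agreement exact. A derived fact with no label on an
existential slot is resolved into the body of its rule. When this is no longer possible, some label
occurs, among derived facts, on existential slots only: otherwise parenthood would produce a cycle
of at most `K` labels, and a colour would recur. All facts carrying that label come from the same
rule with similar frontiers, so they merge into one; this removes a label and costs one level of
truncation. If only database facts remain, agreement is already exact, because truncation preserves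
constants. -/

lemma map_map (f : A → B) (g : B → E) (a : Atom σ A) : (a.map f).map g = a.map (g ∘ f) := rfl

lemma argList_map (f : A → B) (a : Atom σ A) : (a.map f).argList = a.argList.map f := by
  simp [argList, map, List.map_ofFn, Function.comp_def]

lemma map_congr {f g : A → B} {a : Atom σ A} (h : ∀ x ∈ a.argList, f x = g x) :
    a.map f = a.map g := by
  have : (fun i => f (a.args i)) = fun i => g (a.args i) := by
    funext i
    exact h _ (by simp [argList])
  simp only [map, this]

/-- Two atoms with a common image are the projections of an atom over the fibre product. -/
lemma exists_pair {f : A → E} {g : B → E} {a : Atom σ A} {b : Atom σ B}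
    (h : a.map f = b.map g) :
    ∃ c : Atom σ (A × B), c.map Prod.fst = a ∧ c.map Prod.snd = b ∧
      ∀ q ∈ c.argList, f q.1 = g q.2 := by
  obtain ⟨r, x⟩ := a
  obtain ⟨r', y⟩ := b
  simp only [map, mk.injEq] at h
  obtain ⟨rfl, h⟩ := h
  have h := eq_of_heq h
  refine ⟨⟨r, fun i => (x i, y i)⟩, rfl, rfl, ?_⟩
  intro q hq
  simp only [argList, List.mem_ofFn] at hq
  obtain ⟨i, rfl⟩ := hq
  exact congrFun h i

end Atom

/-- A list of pairs without repeated first components is the graph of a partial function. -/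
lemma exists_fun_of_nodup_fst {A B : Type*} [Nonempty B] (l : List (A × B))
    (h : (l.map Prod.fst).Nodup) : ∃ g : A → B, ∀ q ∈ l, g q.1 = q.2 := by
  classical
  refine ⟨fun a => if h : ∃ b, (a, b) ∈ l then h.choose else Classical.arbitrary B, ?_⟩
  rintro ⟨a, b⟩ hq
  have hex : ∃ b, (a, b) ∈ l := ⟨b, hq⟩
  have := List.inj_on_of_nodup_map h hex.choose_spec hq rfl
  simp only [hex, dif_pos]
  exact congrArg Prod.snd this

lemma TGD.mem_bodyVars {σ : Signature.{u}} {r : TGD σ} {x : Var} :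
    x ∈ r.bodyVars ↔ ∃ a ∈ r.body, x ∈ a.argList := by
  simp [TGD.bodyVars]

/-- In a joinless rule, values for the variables may be prescribed in every body atom
independently. -/
lemma TGD.IsJoinless.exists_glue {σ : Signature.{u}} {B : Type*} [Nonempty B] {r : TGD σ}
    (hr : r.IsJoinless) (c : Atom σ Var → Atom σ (Var × B))
    (hc : ∀ a ∈ r.body, (c a).map Prod.fst = a) :
    ∃ g : Var → B, ∀ a ∈ r.body, ∀ q ∈ (c a).argList, g q.1 = q.2 := by
  obtain ⟨g, hg⟩ := exists_fun_of_nodup_fst (r.body.flatMap fun a => (c a).argList) (by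
    have : (r.body.flatMap fun a => (c a).argList).map Prod.fst = r.bodyVars := by
      rw [List.map_flatMap, TGD.bodyVars]
      refine List.flatMap_congr fun a ha => ?_
      rw [← Atom.argList_map, hc a ha]
    rw [this]
    exact hr)
  exact ⟨g, fun a ha q hq => hg q (List.mem_flatMap.2 ⟨a, ha, hq⟩)⟩

/-- A homomorphic image of a model of a set of joinless rules is a model. -/
lemma Struct.SatTGDs.image {σ : Signature.{u}} {A B : Type*} [Nonempty A] {S : Struct σ A}
    {T : Set (TGD σ)} (hT : ∀ r ∈ T, r.IsJoinless) (hS : S.SatTGDs T) (h : A → B) :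
    Struct.SatTGDs (Atom.map h '' S) T := by
  intro r hr τ hτ
  -- Each body atom chooses a preimage fact; `c` pairs its variables with their lifted values.
  have hex : ∀ a : Atom σ Var, ∃ c : Atom σ (Var × A), a ∈ r.body →
      c.map Prod.fst = a ∧ c.map Prod.snd ∈ S ∧ ∀ q ∈ c.argList, τ q.1 = h q.2 := by
    intro a
    by_cases ha : a ∈ r.body
    · obtain ⟨f, hf, hfa⟩ := hτ a ha
      obtain ⟨c, h1, rfl, h3⟩ := Atom.exists_pair hfa.symm
      exact ⟨c, fun _ => ⟨h1, hf, h3⟩⟩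
    · exact ⟨a.map fun x => (x, Classical.arbitrary A), fun h => absurd h ha⟩
  choose c hc using hex
  obtain ⟨g, hg⟩ := (hT r hr).exists_glue c fun a ha => (hc a ha).1
  obtain ⟨τ', h1, h2⟩ := hS r hr g (by
    intro a ha
    obtain ⟨e1, e2, -⟩ := hc a ha
    have : (c a).map Prod.snd = a.map g := by
      conv_rhs => rw [← e1]
      exact Atom.map_congr fun q hq => (hg a ha q hq).symm
    rwa [← this])
  refine ⟨h ∘ τ', fun x hx => ?_, _, h2, rfl⟩
  obtain ⟨a, ha, hxa⟩ := TGD.mem_bodyVars.1 hx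
  obtain ⟨e1, -, e3⟩ := hc a ha
  rw [← e1, Atom.argList_map] at hxa
  obtain ⟨q, hq, rfl⟩ := List.mem_map.1 hxa
  simp only [Function.comp_apply]
  rw [h1 _ hx, hg a ha q hq, e3 q hq]

/-! ### The chase as a model -/

section ChaseBasics

variable {σ : Signature.{u}} {C : Type v} {T : Set (TGD σ)} {D : Struct σ C}

lemma chaseStage_mono : Monotone (chaseStage T D) :=
  monotone_nat_of_le_succ fun _ => Set.subset_union_left

lemma chaseStage_subset_chase (i : ℕ) : chaseStage T D i ⊆ chase T D :=
  Set.subset_iUnion _ i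

lemma exists_stage_holdsAt (φ : CQ σ) (τ : Var → ChaseElem σ C)
    (h : (chase T D).HoldsAt φ τ) : ∃ i, (chaseStage T D i).HoldsAt φ τ := by
  induction φ with
  | nil => exact ⟨0, fun a ha => by simp at ha⟩
  | cons a φ ih =>
    obtain ⟨i, hi⟩ := ih fun b hb => h b (List.mem_cons_of_mem _ hb)
    obtain ⟨j, hj⟩ := Set.mem_iUnion.1 (h a List.mem_cons_self)
    refine ⟨max i j, fun b hb => ?_⟩
    rcases List.mem_cons.1 hb with rfl | hb
    · exact chaseStage_mono (le_max_right _ _) hj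
    · exact chaseStage_mono (le_max_left _ _) (hi b hb)

lemma TGD.witness_of_mem {r : TGD σ} {τ : Var → ChaseElem σ C} {x : Var}
    (hx : x ∈ r.bodyVars) : r.witness τ x = τ x := if_pos hx

lemma TGD.witness_of_notMem {r : TGD σ} {τ : Var → ChaseElem σ C} {x : Var}
    (hx : x ∉ r.bodyVars) : r.witness τ x = ChaseElem.null r x (fun z => τ z) := if_neg hx

lemma satTGDs_chase : (chase T D).SatTGDs T := by
  intro r hr τ hτ
  obtain ⟨i, hi⟩ := exists_stage_holdsAt _ _ hτ
  by_cases hh : r.HeadHoldsAt (chaseStage T D i) τ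
  · obtain ⟨τ', h1, h2⟩ := hh
    exact ⟨τ', h1, chaseStage_subset_chase _ h2⟩
  · exact ⟨r.witness τ, fun x hx => TGD.witness_of_mem hx,
      chaseStage_subset_chase (i + 1) (Or.inr ⟨r, hr, τ, hi, hh, rfl⟩)⟩

end ChaseBasics

lemma TGD.finite_frontier {σ : Signature.{u}} (r : TGD σ) : r.frontier.Finite :=
  r.bodyVars.finite_toSet.subset fun _ h => h.1

instance {σ : Signature.{u}} (r : TGD σ) : Finite r.frontier := r.finite_frontier

end Datalog

namespace Datalog

/-! ### Colours, truncation and finiteness of the quotient -/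

namespace ChaseElem

variable {σ : Signature.{u}} {C : Type v}

/-- Every null has a colour, the least one that is carried by none of its proper ancestors up to
distance `K`. The set `info K t` consists of the pairs `(j, c)` with `j ≤ K` such that `t` has an
ancestor of colour `c` at distance `j`. -/
noncomputable def info (K : ℕ) : ChaseElem σ C → Set (ℕ × ℕ)
  | const _ => ∅
  | null _ _ f =>
    insert (0, sInf {c | ∀ x, ∀ j < K, (j, c) ∉ info K (f x)})
      {p | ∃ x, ∃ j < K, ∃ c, p = (j + 1, c) ∧ (j, c) ∈ info K (f x)}

/-- Cut a term at depth `n`, and replace the nulls at this depth by their `info`. -/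
noncomputable def trunc (K : ℕ) : ℕ → ChaseElem σ C → ChaseElem σ (C ⊕ Set (ℕ × ℕ))
  | _, const c => const (Sum.inl c)
  | 0, null r y f => const (Sum.inr (info K (null r y f)))
  | n + 1, null r y f => null r y fun x => trunc K n (f x)

/-- The terms with constants from `S` and nulls for the existential variables of rules from `T`. -/
def Over (T : Set (TGD σ)) (S : Set C) : ChaseElem σ C → Prop
  | const c => c ∈ S
  | null r y f => r ∈ T ∧ y ∈ r.head.argList ∧ ∀ x, Over T S (f x)

variable {K : ℕ}

lemma finite_info (t : ChaseElem σ C) : (info K t).Finite := by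
  induction t with
  | const c => simp [info]
  | null r y f ih =>
    refine Set.Finite.insert _ (((Set.finite_iUnion ih).image fun p => (p.1 + 1, p.2)).subset ?_)
    rintro p ⟨x, j, -, c, rfl, h⟩
    exact ⟨(j, c), Set.mem_iUnion.2 ⟨x, h⟩, rfl⟩

/-- The colour of a null differs from those of its proper ancestors up to distance `K`. -/
lemma exists_colour (r : TGD σ) (y : Var) (f : r.frontier → ChaseElem σ C) :
    ∃ c, (0, c) ∈ info K (null r y f) ∧ ∀ j < K, (j + 1, c) ∉ info K (null r y f) := by
  have hne : {c | ∀ x, ∀ j < K, (j, c) ∉ info K (f x)}.Nonempty := by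
    have hfin : (Prod.snd '' ⋃ x, info K (f x)).Finite :=
      (Set.finite_iUnion fun x => finite_info (f x)).image _
    obtain ⟨c, hc⟩ := hfin.infinite_compl.nonempty
    exact ⟨c, fun x j _ h => hc ⟨(j, c), Set.mem_iUnion.2 ⟨x, h⟩, rfl⟩⟩
  refine ⟨_, Set.mem_insert _ _, fun j hj h => ?_⟩
  rcases h with h | ⟨x, i, hi, c, he, h⟩
  · simp at h
  · obtain ⟨h1, rfl⟩ := Prod.mk.inj he
    obtain rfl := Nat.succ.inj h1
    exact Nat.sInf_mem hne x j hi h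

lemma mem_info_null {r : TGD σ} (y : Var) {f : r.frontier → ChaseElem σ C} (x : r.frontier)
    {j c : ℕ} (hj : j < K) (h : (j, c) ∈ info K (f x)) : (j + 1, c) ∈ info K (null r y f) :=
  Set.mem_insert_of_mem _ ⟨x, j, hj, c, rfl, h⟩

lemma info_null_congr {r : TGD σ} (y : Var) {f g : r.frontier → ChaseElem σ C}
    (h : ∀ x, info K (f x) = info K (g x)) : info K (null r y f) = info K (null r y g) := by
  simp only [info, h]

/-- The cut stores `info`, and the `info` of a null depends only on that of its parents, so it can
be recomputed from the cut upwards. -/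
lemma info_eq_of_trunc_eq {n : ℕ} {s t : ChaseElem σ C} (h : trunc K n s = trunc K n t) :
    info K s = info K t := by
  induction n generalizing s t with
  | zero =>
    cases s <;> cases t <;> simp only [trunc, const.injEq, Sum.inl.injEq, Sum.inr.injEq,
      reduceCtorEq] at h
    · rw [h]
    · exact h
  | succ n ih =>
    cases s <;> cases t <;> simp only [trunc, const.injEq, Sum.inl.injEq, reduceCtorEq] at h
    · rw [h]
    · injection h with h1 h2 h3
      subst h1 h2
      exact info_null_congr _ fun x => ih (congrFun (eq_of_heq h3) x)

lemma trunc_eq_of_trunc_succ_eq {n : ℕ} {s t : ChaseElem σ C}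
    (h : trunc K (n + 1) s = trunc K (n + 1) t) : trunc K n s = trunc K n t := by
  induction n generalizing s t with
  | zero =>
    have hi := info_eq_of_trunc_eq h
    cases s <;> cases t <;> simp only [trunc, const.injEq, Sum.inl.injEq, Sum.inr.injEq,
      reduceCtorEq] at h ⊢
    · exact h
    · exact hi
  | succ n ih =>
    cases s <;> cases t <;> simp only [trunc, const.injEq, Sum.inl.injEq, reduceCtorEq] at h ⊢
    · exact h
    · injection h with h1 h2 h3
      subst h1 h2
      congr 1
      funext x
      exact ih (congrFun (eq_of_heq h3) x)

/-- All nulls of one rule application have the same frontier, so similarity of one gives similarity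
of the others. -/
lemma trunc_null_congr {n : ℕ} {r : TGD σ} {y : Var} (z : Var) {f g : r.frontier → ChaseElem σ C}
    (h : trunc K (n + 1) (null r y f) = trunc K (n + 1) (null r y g)) :
    trunc K (n + 1) (null r z f) = trunc K (n + 1) (null r z g) := by
  simp only [trunc] at h ⊢
  injection h with h1 h2 h3
  rw [h3]

/-- A null has at most `m` parents, hence at most `m ^ j` ancestors at distance `j`, counted by
paths. -/
lemma encard_layer_le {T : Set (TGD σ)} {S : Set C} {m : ℕ}
    (hm : ∀ r ∈ T, Nat.card r.frontier ≤ m) (j : ℕ) {t : ChaseElem σ C} (ht : t.Over T S) :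
    {c | (j, c) ∈ info K t}.encard ≤ (m ^ j : ℕ) := by
  induction j generalizing t with
  | zero =>
    cases t with
    | const c => simp [info]
    | null r y f =>
      refine (Set.encard_le_encard (t := {sInf {c | ∀ x, ∀ j < K, (j, c) ∉ info K (f x)}})
        ?_).trans (by simp)
      intro c hc
      rcases hc with h | ⟨x, i, hi, d, he, h⟩
      · simpa using h
      · simp at he
  | succ j ih =>
    cases t with
    | const c => simp [info]
    | null r y f =>
      have hsub : {c | (j + 1, c) ∈ info K (null r y f)} ⊆ ⋃ x, {c | (j, c) ∈ info K (f x)} := by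
        intro c hc
        rcases hc with h | ⟨x, i, hi, d, he, h⟩
        · simp at h
        · obtain ⟨rfl, rfl⟩ : j = i ∧ c = d := by simpa using he
          exact Set.mem_iUnion.2 ⟨x, h⟩
      have := Fintype.ofFinite r.frontier
      refine (Set.encard_le_encard hsub).trans ((Set.encard_iUnion_le_of_fintype _).trans ?_)
      refine (Finset.sum_le_card_nsmul _ _ _ fun x _ => ih (ht.2.2 x)).trans ?_
      rw [nsmul_eq_mul, ← Nat.cast_mul, Nat.cast_le, pow_succ', Finset.card_univ,
        ← Nat.card_eq_fintype_card]
      exact Nat.mul_le_mul_right _ (hm r ht.1)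

lemma exists_colour_bound {T : Set (TGD σ)} (hT : T.Finite) (S : Set C) (K : ℕ) :
    ∃ P, ∀ t : ChaseElem σ C, t.Over T S → info K t ⊆ Set.Iic K ×ˢ Set.Iic P := by
  obtain ⟨m, hm⟩ : ∃ m, ∀ r ∈ T, Nat.card r.frontier ≤ m := by
    obtain ⟨m, hm⟩ := (hT.image fun r => Nat.card r.frontier).bddAbove
    exact ⟨m, fun r hr => hm ⟨r, hr, rfl⟩⟩
  -- At most `m` parents, `K` layers above each, and at most `(m + 1) ^ K` colours per layer; `m +
  -- 1` keeps the power monotone in the exponent when `m = 0`.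
  refine ⟨m * (K * (m + 1) ^ K), fun t ht => ?_⟩
  induction t with
  | const c => simp [info]
  | null r y f ih =>
    intro p hp
    rcases hp with rfl | ⟨x, j, hj, c, rfl, h⟩
    · refine ⟨Nat.zero_le _, ?_⟩
      set c := sInf {c | ∀ x, ∀ j < K, (j, c) ∉ info K (f x)} with hc
      -- By minimality, every colour below `c` is carried by a near ancestor.
      have hsub : Set.Iio c ⊆ ⋃ x, ⋃ j : Fin K, {d | ((j : ℕ), d) ∈ info K (f x)} := by
        intro d hd
        have := Nat.notMem_of_lt_sInf hd
        simp only [Set.mem_ofPred_eq, not_forall, not_not] at this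
        obtain ⟨x, j, hj, h⟩ := this
        exact Set.mem_iUnion.2 ⟨x, Set.mem_iUnion.2 ⟨⟨j, hj⟩, h⟩⟩
      have := Fintype.ofFinite r.frontier
      have hle : (c : ℕ∞) ≤ (m * (K * (m + 1) ^ K) : ℕ) := by
        have hcard : (Set.Iio c).encard = c := by
          rw [← Finset.coe_Iio, Set.encard_coe_eq_coe_finsetCard, Nat.card_Iio]
        rw [← hcard]
        refine (Set.encard_le_encard hsub).trans ((Set.encard_iUnion_le_of_fintype _).trans ?_)
        refine (Finset.sum_le_card_nsmul _ _ ((K * (m + 1) ^ K : ℕ) : ℕ∞) fun x _ => ?_).trans ?_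
        · refine (Set.encard_iUnion_le_of_fintype _).trans ?_
          refine (Finset.sum_le_card_nsmul _ _ (((m + 1) ^ K : ℕ) : ℕ∞) fun j _ => ?_).trans ?_
          · refine (encard_layer_le hm j (ht.2.2 x)).trans ?_
            rw [Nat.cast_le]
            exact (Nat.pow_le_pow_left m.le_succ _).trans
              (Nat.pow_le_pow_right m.succ_pos j.2.le)
          · rw [nsmul_eq_mul, ← Nat.cast_mul, Finset.card_univ, Fintype.card_fin]
        · rw [nsmul_eq_mul, ← Nat.cast_mul, Nat.cast_le, Finset.card_univ,
            ← Nat.card_eq_fintype_card]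
          exact Nat.mul_le_mul_right _ (hm r ht.1)
      exact_mod_cast hle
    · exact ⟨hj, (ih x (ht.2.2 x) h).2⟩

lemma finite_trunc_image {T : Set (TGD σ)} (hT : T.Finite) {S : Set C} (hS : S.Finite) (K n : ℕ) :
    (trunc K n '' {t : ChaseElem σ C | t.Over T S}).Finite := by
  induction n with
  | zero =>
    obtain ⟨P, hP⟩ := exists_colour_bound hT S K
    have hfin : (Set.Iic K ×ˢ Set.Iic P).Finite := (Set.finite_Iic K).prod (Set.finite_Iic P)
    refine ((hS.image fun c => const (Sum.inl c)).union
      (hfin.finite_subsets.image fun I => const (Sum.inr I))).subset ?_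
    rintro _ ⟨t, ht, rfl⟩
    cases t with
    | const c => exact Or.inl ⟨c, ht, rfl⟩
    | null r y f => exact Or.inr ⟨_, hP _ ht, rfl⟩
  | succ n ih =>
    refine ((hS.image fun c => const (Sum.inl c)).union (hT.biUnion fun r _ =>
      (r.head.argList.finite_toSet).biUnion fun y _ =>
        (Set.Finite.pi' fun _ : r.frontier => ih).image fun g => null r y g)).subset ?_
    rintro _ ⟨t, ht, rfl⟩
    cases t with
    | const c => exact Or.inl ⟨c, ht, rfl⟩
    | null r y f =>
      refine Or.inr (Set.mem_biUnion ht.1 (Set.mem_biUnion ht.2.1 ⟨_, fun x => ?_, rfl⟩))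
      exact ⟨f x, ht.2.2 x, rfl⟩

end ChaseElem

lemma over_of_mem_chase {σ : Signature.{u}} {C : Type v} {T : Set (TGD σ)} {D : Struct σ C}
    {S : Set C} (hS : D.adom ⊆ S) {f : Atom σ (ChaseElem σ C)} (hf : f ∈ chase T D) :
    ∀ t ∈ f.argList, t.Over T S := by
  obtain ⟨i, hi⟩ := Set.mem_iUnion.1 hf
  clear hf
  induction i generalizing f with
  | zero =>
    obtain ⟨g, hg, rfl⟩ := hi
    intro t ht
    rw [Atom.argList_map] at ht
    obtain ⟨c, hc, rfl⟩ := List.mem_map.1 ht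
    exact hS ⟨g, hg, hc⟩
  | succ i ih =>
    rcases hi with hi | ⟨r, hr, τ, hb, -, rfl⟩
    · exact ih hi
    · have hτ : ∀ x ∈ r.bodyVars, (τ x).Over T S := by
        intro x hx
        obtain ⟨a, ha, hxa⟩ := TGD.mem_bodyVars.1 hx
        refine ih (hb a ha) _ ?_
        rw [Atom.argList_map]
        exact List.mem_map_of_mem hxa
      intro t ht
      rw [Atom.argList_map] at ht
      obtain ⟨x, hx, rfl⟩ := List.mem_map.1 ht
      by_cases hxb : x ∈ r.bodyVars
      · rw [TGD.witness_of_mem hxb]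
        exact hτ x hxb
      · rw [TGD.witness_of_notMem hxb]
        exact ⟨hr, hx, fun z => hτ z z.2.1⟩

end Datalog

/-! ### Labelled facts and their exact satisfaction -/

namespace Datalog

open ChaseElem

variable {σ : Signature.{u}} {C : Type v}

/-- A fact `pat.map val` of the chase, some of whose slots (the variables of `pat`) are required to
agree with the values of the labels they carry. -/
structure LabelledFact (σ : Signature.{u}) (C : Type v) where
  pat : Atom σ Var
  val : Var → ChaseElem σ C
  rank : ℕ
  label : Var → ℕ → Prop

namespace LabelledFact

/-- The fact belongs to the database. -/
def IsLeaf (T : Set (TGD σ)) (D : Struct σ C) (i : LabelledFact σ C) : Prop :=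
  (∀ s ∈ i.pat.argList, ∃ c, i.val s = const c) ∧ i.pat.map i.val ∈ chase T D

/-- The fact is derived by the rule `r` under the valuation `τ`. -/
def IsDerived (T : Set (TGD σ)) (D : Struct σ C) (i : LabelledFact σ C) (r : TGD σ)
    (τ : Var → ChaseElem σ C) : Prop :=
  r ∈ T ∧ i.pat = r.head ∧ i.val = r.witness τ ∧ i.pat.map i.val ∈ chase T D ∧
    ∃ k < i.rank, (chaseStage T D k).HoldsAt r.body τ

def IsJustified (T : Set (TGD σ)) (D : Struct σ C) (i : LabelledFact σ C) : Prop :=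
  (∀ s x, i.label s x → s ∈ i.pat.argList) ∧ (i.IsLeaf T D ∨ ∃ r τ, i.IsDerived T D r τ)

/-- Up to `trunc K n`, the values of the slots agree with the values of their labels. -/
def Approx (K n : ℕ) (t : ℕ → ChaseElem σ C) (i : LabelledFact σ C) : Prop :=
  ∀ s x, i.label s x → trunc K n (i.val s) = trunc K n (t x)

/-- The slots can be revalued such that they agree with their labels. -/
def Sat (T : Set (TGD σ)) (D : Struct σ C) (ρ : ℕ → ChaseElem σ C) (i : LabelledFact σ C) : Prop :=
  ∃ v : Var → ChaseElem σ C, i.pat.map v ∈ chase T D ∧ ∀ s x, i.label s x → v s = ρ x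

variable {T : Set (TGD σ)} {D : Struct σ C}

/-- The pattern of a database fact has its positions as distinct slots; that of a derived fact is
the rule head, which keeps the repetitions of variables. Labels are left open, to be chosen once the
pattern is known. -/
lemma exists_of_mem_stage [Nonempty C] {k : ℕ} {f : Atom σ (ChaseElem σ C)} (hf : f ∈ chaseStage T D k) :
    ∃ (pat : Atom σ Var) (val : Var → ChaseElem σ C), pat.map val = f ∧
      ∀ L : Var → ℕ → Prop, (∀ s x, L s x → s ∈ pat.argList) →
        IsJustified T D ⟨pat, val, k, L⟩ := by
  induction k with
  | zero =>
    have hfc := chaseStage_subset_chase 0 hf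
    obtain ⟨d, hd, rfl⟩ := hf
    have c₀ : C := Classical.arbitrary C
    let val : Var → ChaseElem σ C := fun s =>
      if h : s < σ.arity d.rel then const (d.args ⟨s, h⟩) else const c₀
    have hval : (⟨d.rel, fun p => p.1⟩ : Atom σ Var).map val = d.map const := by
      simp [Atom.map, val]
    refine ⟨⟨d.rel, fun p => p.1⟩, val, hval, fun L hL => ⟨hL, Or.inl ⟨fun s _ => ?_, ?_⟩⟩⟩
    · by_cases h : s < σ.arity d.rel <;> simp [val, h]
    · simpa only [hval] using hfc
  | succ k ih =>
    rcases id hf with h | ⟨r, hr, τ, hb, -, rfl⟩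
    · obtain ⟨pat, val, he, hj⟩ := ih h
      refine ⟨pat, val, he, fun L hL => ⟨hL, ?_⟩⟩
      rcases (hj L hL).2 with h | ⟨r, τ, h1, h2, h3, h4, j, hlt, h5⟩
      · exact Or.inl h
      · exact Or.inr ⟨r, τ, h1, h2, h3, h4, j, hlt.trans k.lt_succ_self, h5⟩
    · exact ⟨r.head, r.witness τ, rfl, fun L hL => ⟨hL, Or.inr ⟨r, τ, hr, rfl, rfl,
        chaseStage_subset_chase _ hf, k, k.lt_succ_self, hb⟩⟩⟩

/-- A derived fact without labels at its existential slots can be replaced by the body of the rule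
which derives it. -/
lemma exists_resolution [Nonempty C] (hT : ∀ r ∈ T, r.IsJoinless) {K n : ℕ} {t : ℕ → ChaseElem σ C}
    {i : LabelledFact σ C} {r : TGD σ} {τ : Var → ChaseElem σ C} (hi : i.IsDerived T D r τ)
    (hL : ∀ s x, i.label s x → s ∈ r.bodyVars) (ht : i.Approx K n t) :
    ∃ l : List (LabelledFact σ C), l.length = r.body.length ∧
      (∀ j ∈ l, j.IsJustified T D ∧ j.Approx K n t ∧ j.rank < i.rank ∧
        ∀ s x, j.label s x → ∃ s', i.label s' x) ∧
      ∀ ρ, (∀ j ∈ l, j.Sat T D ρ) → i.Sat T D ρ := by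
  obtain ⟨hr, hpat, hval, -, k, hk, hb⟩ := hi
  -- `c` pairs the variables of the body atom with the slots of the fact matching it; the labels of
  -- `i` are handed down along these pairs.
  have hex : ∀ a : Atom σ Var, ∃ (c : Atom σ (Var × Var)) (j : LabelledFact σ C), a ∈ r.body →
      c.map Prod.fst = a ∧ c.map Prod.snd = j.pat ∧ (∀ q ∈ c.argList, τ q.1 = j.val q.2) ∧
      j.IsJustified T D ∧ j.rank = k ∧
      ∀ s x, j.label s x ↔ ∃ q ∈ c.argList, q.2 = s ∧ i.label q.1 x := by
    intro a
    by_cases ha : a ∈ r.body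
    · obtain ⟨pat, val, he, hj⟩ := exists_of_mem_stage (hb a ha)
      obtain ⟨c, h1, h2, h3⟩ := Atom.exists_pair he.symm
      refine ⟨c, ⟨pat, val, k, fun s x => ∃ q ∈ c.argList, q.2 = s ∧ i.label q.1 x⟩, fun _ =>
        ⟨h1, h2, h3, hj _ ?_, rfl, fun _ _ => Iff.rfl⟩⟩
      rintro s x ⟨q, hq, rfl, -⟩
      rw [← h2, Atom.argList_map]
      exact List.mem_map_of_mem hq
    · exact ⟨a.map fun x => (x, x), i, fun h => absurd h ha⟩
  choose c j hcj using hex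
  refine ⟨r.body.map j, by simp, ?_, ?_⟩
  · intro j' hj'
    obtain ⟨a, ha, rfl⟩ := List.mem_map.1 hj'
    obtain ⟨h1, h2, h3, h4, h5, h6⟩ := hcj a ha
    refine ⟨h4, ?_, h5 ▸ hk, ?_⟩
    · intro s x hs
      obtain ⟨q, hq, rfl, hl⟩ := (h6 s x).1 hs
      rw [← h3 q hq, ← ht _ _ hl, hval, TGD.witness_of_mem (hL _ _ hl)]
    · intro s x hs
      obtain ⟨q, hq, -, hl⟩ := (h6 s x).1 hs
      exact ⟨_, hl⟩
  · intro ρ hρ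
    have hex : ∀ a : Atom σ Var, ∃ v : Var → ChaseElem σ C, a ∈ r.body →
        (j a).pat.map v ∈ chase T D ∧ ∀ s x, (j a).label s x → v s = ρ x := by
      intro a
      by_cases ha : a ∈ r.body
      · obtain ⟨v, hv⟩ := hρ _ (List.mem_map_of_mem ha)
        exact ⟨v, fun _ => hv⟩
      · exact ⟨τ, fun h => absurd h ha⟩
    choose v hv using hex
    have : Nonempty (ChaseElem σ C) := ⟨τ 0⟩
    obtain ⟨g, hg⟩ := (hT r hr).exists_glue (fun a => (c a).map (Prod.map id (v a)))
      fun a ha => (hcj a ha).1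
    have hg' : ∀ a ∈ r.body, ∀ q ∈ (c a).argList, g q.1 = v a q.2 := by
      intro a ha q hq
      refine hg a ha (Prod.map id (v a) q) ?_
      rw [Atom.argList_map]
      exact List.mem_map_of_mem hq
    -- The head fact found here has the prescribed frontier but uncontrolled witnesses, which is why
    -- `hL` forbids labels on existential slots.
    obtain ⟨τ', h1, h2⟩ := satTGDs_chase (D := D) r hr g (by
      intro a ha
      obtain ⟨e1, e2, -⟩ := hcj a ha
      have : (j a).pat.map (v a) = a.map g := by
        rw [← e2]
        conv_rhs => rw [← e1]
        exact Atom.map_congr fun q hq => (hg' a ha q hq).symm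
      rw [← this]
      exact (hv a ha).1)
    refine ⟨τ', hpat ▸ h2, fun s x hs => ?_⟩
    obtain ⟨a, ha, hsa⟩ := TGD.mem_bodyVars.1 (hL s x hs)
    obtain ⟨e1, -, -, -, -, e6⟩ := hcj a ha
    rw [h1 s (hL s x hs)]
    rw [← e1, Atom.argList_map] at hsa
    obtain ⟨q, hq, rfl⟩ := List.mem_map.1 hsa
    rw [hg' a ha q hq]
    exact (hv a ha).2 _ _ ((e6 _ _).2 ⟨q, hq, rfl, hs⟩)

end LabelledFact

open LabelledFact

variable {T : Set (TGD σ)} {D : Struct σ C}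

/-- Some label of an existential slot labels no other kind of slot of a derived fact. -/
lemma exists_maximal_label {K n : ℕ} {t : ℕ → ChaseElem σ C} {l : List (LabelledFact σ C)}
    {Y : Finset ℕ} (hY : Y.card ≤ K) (hlY : ∀ i ∈ l, ∀ s x, i.label s x → x ∈ Y)
    (hj : ∀ i ∈ l, i.IsJustified T D) (ht : ∀ i ∈ l, i.Approx K n t)
    (hstuck : ∀ i ∈ l, ∀ r τ, i.IsDerived T D r τ → ∃ s x, i.label s x ∧ s ∉ r.bodyVars)
    (hex : ∃ i ∈ l, ∃ r τ, i.IsDerived T D r τ) :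
    ∃ y, (∃ i ∈ l, ∃ r τ, i.IsDerived T D r τ ∧ ∃ s, i.label s y ∧ s ∉ r.bodyVars) ∧
      ∀ i ∈ l, ∀ r τ, i.IsDerived T D r τ → ∀ s, i.label s y → s ∉ r.bodyVars := by
  by_contra hcon
  push Not at hcon
  let E : ℕ → Prop := fun y =>
    ∃ i ∈ l, ∃ r τ, i.IsDerived T D r τ ∧ ∃ s, i.label s y ∧ s ∉ r.bodyVars
  -- A fact with `y` on a frontier slot also has some `z` on an existential slot; up to truncation,
  -- `t y` is then a parent of `t z`, so colours move one step further away.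
  have hnext : ∀ y : {y // E y}, ∃ z : {y // E y}, ∀ j < K, ∀ c, (j, c) ∈ info K (t y.1) →
      (j + 1, c) ∈ info K (t z.1) := by
    rintro ⟨y, i, hi, r, τ, hd, s, hs, hsb⟩
    obtain ⟨i', hi', r', τ', hd', s', hs', hsb'⟩ :=
      hcon y ⟨i, hi, r, τ, hd, s, hs, hsb⟩
    obtain ⟨s'', z, hz, hzb⟩ := hstuck i' hi' r' τ' hd'
    refine ⟨⟨z, i', hi', r', τ', hd', s'', hz, hzb⟩, fun j hjK c hc => ?_⟩
    have hmem := (hj i' hi').1 _ _ hs'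
    obtain ⟨-, hpat, hval, -⟩ := hd'
    rw [← info_eq_of_trunc_eq (ht i' hi' _ _ hz), hval, TGD.witness_of_notMem hzb]
    rw [← info_eq_of_trunc_eq (ht i' hi' _ _ hs'), hval, TGD.witness_of_mem hsb'] at hc
    exact mem_info_null _ ⟨s', hsb', hpat ▸ hmem⟩ hjK hc
  choose next hnext using hnext
  obtain ⟨i, hi, r, τ, hd⟩ := hex
  obtain ⟨s, y, hs, hsb⟩ := hstuck i hi r τ hd
  let y₀ : {y // E y} := ⟨y, i, hi, r, τ, hd, s, hs, hsb⟩
  let w : ℕ → {y // E y} := fun k => next^[k] y₀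
  have hw : ∀ a d, d ≤ K → ∀ c, (0, c) ∈ info K (t (w a).1) → (d, c) ∈ info K (t (w (a + d)).1) := by
    intro a d
    induction d with
    | zero => exact fun _ c hc => hc
    | succ d ih =>
      intro hd c hc
      have := hnext (w (a + d)) d hd c (ih (by omega) c hc)
      have he : w (a + (d + 1)) = next (w (a + d)) := by
        simp only [w, ← add_assoc, Function.iterate_succ_apply']
      rwa [he]
  -- The walk returns to a label within `Y.card ≤ K` steps, so a null would see its own colour at a
  -- distance between `1` and `K`.
  obtain ⟨a, ha, b, hb, hab, he⟩ := Finset.exists_ne_map_eq_of_card_lt_of_maps_to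
    (s := Finset.range (Y.card + 1)) (t := Y) (f := fun k => (w k).1) (by simp) (by
      intro k _
      obtain ⟨i, hi, r, τ, hd, s, hs, hsb⟩ := (w k).2
      exact hlY i hi s _ hs)
  wlog hlt : a < b generalizing a b
  · exact this b hb a ha hab.symm he.symm (by omega)
  obtain ⟨d, rfl⟩ : ∃ d, b = a + (d + 1) := ⟨b - a - 1, by omega⟩
  obtain ⟨i, hi, r, τ, hd, s, hs, hsb⟩ := (w a).2
  have hinfo := info_eq_of_trunc_eq (ht i hi _ _ hs)
  rw [hd.2.2.1, TGD.witness_of_notMem hsb] at hinfo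
  obtain ⟨c, hc, hc'⟩ := exists_colour (K := K) r s (fun z => τ z)
  rw [hinfo] at hc hc'
  simp only [Finset.mem_range] at ha hb
  have h2 := hw a (d + 1) (by omega) c hc
  have he' : (w (a + (d + 1))).1 = (w a).1 := he.symm
  rw [he'] at h2
  exact hc' d (by omega) h2

/-- Labelled facts whose slots approximately agree with their labels can be satisfied exactly. -/
theorem exists_sat [Nonempty C] (hTfin : T.Finite) (hT : ∀ r ∈ T, r.IsJoinless) {K n : ℕ}
    (t : ℕ → ChaseElem σ C) (Y : Finset ℕ) (hYK : Y.card ≤ K) (hYn : Y.card ≤ n)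
    (l : List (LabelledFact σ C)) (hlY : ∀ i ∈ l, ∀ s x, i.label s x → x ∈ Y)
    (hj : ∀ i ∈ l, i.IsJustified T D) (ht : ∀ i ∈ l, i.Approx K n t) :
    ∃ ρ, ∀ i ∈ l, i.Sat T D ρ := by
  classical
  obtain ⟨B, hB⟩ : ∃ B, ∀ r ∈ T, r.body.length ≤ B := by
    obtain ⟨B, hB⟩ := (hTfin.image fun r => r.body.length).bddAbove
    exact ⟨B, fun r hr => hB ⟨r, hr, rfl⟩⟩
  -- Outer induction on the number of labels, which merging decreases; inner induction on a weight,
  -- which resolution decreases.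
  induction hm : Y.card generalizing Y n l with
  | zero =>
    obtain rfl := Finset.card_eq_zero.1 hm
    refine ⟨t, fun i hi => ⟨i.val, ?_, fun s x hs => absurd (hlY i hi s x hs) (by simp)⟩⟩
    rcases (hj i hi).2 with h | ⟨r, τ, h⟩
    · exact h.2
    · exact h.2.2.2.1
  | succ m ihm =>
  -- Resolution replaces a fact by at most `B` facts of smaller rank, so base `B + 1` makes the
  -- weight drop.
  induction hW : (l.map fun i => (B + 1) ^ i.rank).sum using Nat.strong_induction_on
    generalizing l with
  | _ W ihW =>
  by_cases hres : ∃ i ∈ l, ∃ r τ, i.IsDerived T D r τ ∧ ∀ s x, i.label s x → s ∈ r.bodyVars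
  · obtain ⟨i, hi, r, τ, hd, hL⟩ := hres
    obtain ⟨l', hlen, hl', hsat⟩ := exists_resolution hT hd hL (ht i hi)
    obtain ⟨l₁, l₂, rfl⟩ := List.append_of_mem hi
    have hlt : (l'.map fun i => (B + 1) ^ i.rank).sum < (B + 1) ^ i.rank := by
      obtain ⟨k, hk⟩ : ∃ k, i.rank = k + 1 := by
        obtain ⟨-, -, -, -, k, hk, -⟩ := hd
        exact ⟨i.rank - 1, by omega⟩
      have h1 := List.sum_le_card_nsmul (l'.map fun i => (B + 1) ^ i.rank) ((B + 1) ^ k) (by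
        intro x hx
        obtain ⟨j, hj', rfl⟩ := List.mem_map.1 hx
        have := (hl' j hj').2.2.1
        exact Nat.pow_le_pow_right B.succ_pos (by omega))
      rw [List.length_map, hlen, smul_eq_mul] at h1
      have h2 := Nat.mul_le_mul_right ((B + 1) ^ k) (hB r hd.1)
      have h3 : 0 < (B + 1) ^ k := Nat.pow_pos B.succ_pos
      rw [hk, pow_succ]
      nlinarith
    have hmem : ∀ j ∈ l₁ ++ l' ++ l₂, j ∈ l₁ ++ i :: l₂ ∨ j ∈ l' := by
      intro j hj
      simp only [List.mem_append, List.mem_cons] at hj ⊢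
      tauto
    obtain ⟨ρ, hρ⟩ := ihW _ (by
        subst hW
        simp only [List.map_append, List.sum_append, List.map_cons, List.sum_cons] at hlt ⊢
        omega) (l₁ ++ l' ++ l₂) (by
        intro j hj s x hs
        rcases hmem j hj with h | h
        · exact hlY j h s x hs
        · obtain ⟨s', hs'⟩ := (hl' j h).2.2.2 s x hs
          exact hlY i hi s' x hs')
      (fun j h => (hmem j h).elim (hj j) fun h => (hl' j h).1)
      (fun j h => (hmem j h).elim (ht j) fun h => (hl' j h).2.1) rfl
    refine ⟨ρ, fun j h => ?_⟩
    rcases List.mem_append.1 h with h | h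
    · exact hρ j (by simp [h])
    rcases List.mem_cons.1 h with rfl | h
    · exact hsat ρ fun j h => hρ j (by simp [h])
    · exact hρ j (by simp [h])
  push Not at hres
  by_cases hex : ∃ i ∈ l, ∃ r τ, i.IsDerived T D r τ
  · obtain ⟨y, ⟨i₀, hi₀, r, τ₀, hd₀, s₀, hs₀, hsb₀⟩, hmax⟩ :=
      exists_maximal_label hYK hlY hj ht hres hex
    obtain ⟨n, rfl⟩ : ∃ n', n = n' + 1 := ⟨n - 1, by omega⟩
    have hyY := hlY i₀ hi₀ _ _ hs₀
    have hval₀ : i₀.val s₀ = null r s₀ (fun z => τ₀ z) := by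
      rw [hd₀.2.2.1, TGD.witness_of_notMem hsb₀]
    -- All facts with the label `y` are derived by the same rule, with similar frontiers.
    have hy : ∀ i ∈ l, ∀ s, i.label s y → s = s₀ ∧ i.pat = r.head ∧
        ∀ z ∈ r.head.argList, trunc K n (i.val z) = trunc K n (i₀.val z) := by
      intro i hi s hs
      have he : trunc K (n + 1) (i.val s) = trunc K (n + 1) (i₀.val s₀) :=
        (ht i hi _ _ hs).trans (ht i₀ hi₀ _ _ hs₀).symm
      rcases (hj i hi).2 with h | ⟨r', τ, hd⟩
      · obtain ⟨c, hc⟩ := h.1 s ((hj i hi).1 _ _ hs)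
        rw [hc, hval₀] at he
        simp [trunc] at he
      · have hsb := hmax i hi r' τ hd s hs
        rw [hval₀, hd.2.2.1, TGD.witness_of_notMem hsb] at he
        obtain ⟨rfl, rfl⟩ : r' = r ∧ s = s₀ := by
          simp only [trunc] at he
          injection he with h1 h2
          exact ⟨h1, h2⟩
        refine ⟨rfl, hd.2.1, fun z hz => ?_⟩
        rw [hd.2.2.1, hd₀.2.2.1]
        by_cases hzb : z ∈ r'.bodyVars
        · rw [TGD.witness_of_mem hzb, TGD.witness_of_mem hzb]
          simp only [trunc] at he
          injection he with _ _ h3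
          exact congrFun h3 ⟨z, hzb, hz⟩
        · rw [TGD.witness_of_notMem hzb, TGD.witness_of_notMem hzb]
          exact trunc_eq_of_trunc_succ_eq (trunc_null_congr z he)
    -- One representative replaces all facts carrying `y` and inherits their other labels.
    let i₁ : LabelledFact σ C :=
      { i₀ with label := fun s x => x ≠ y ∧ ∃ i ∈ l, (∃ s', i.label s' y) ∧ i.label s x }
    let l' := i₁ :: l.filter fun i => ¬ ∃ s, i.label s y
    have hl' : ∀ i ∈ l', i = i₁ ∨ i ∈ l ∧ ¬ ∃ s, i.label s y := by
      intro i hi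
      simpa [l'] using hi
    obtain ⟨ρ, hρ⟩ := ihm (n := n) (Y.erase y)
      (by have := Finset.card_erase_le (s := Y) (a := y); omega)
      (by rw [Finset.card_erase_of_mem hyY]; omega) l'
      (by
        intro i hi s x hs
        rcases hl' i hi with rfl | ⟨hi, hn⟩
        · obtain ⟨hne, i, hi, -, hs⟩ := hs
          exact Finset.mem_erase.2 ⟨hne, hlY i hi s x hs⟩
        · refine Finset.mem_erase.2 ⟨?_, hlY i hi s x hs⟩
          rintro rfl
          exact hn ⟨s, hs⟩)
      (by
        intro i hi
        rcases hl' i hi with rfl | ⟨hi, hn⟩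
        · refine ⟨?_, Or.inr ⟨r, τ₀, hd₀⟩⟩
          rintro s x ⟨-, i, hi, ⟨s', hs'⟩, hs⟩
          have h1 := (hj i hi).1 s x hs
          rw [(hy i hi s' hs').2.1] at h1
          exact hd₀.2.1 ▸ h1
        · exact hj i hi)
      (by
        intro i hi s x hs
        rcases hl' i hi with rfl | ⟨hi, hn⟩
        · obtain ⟨-, i, hi, ⟨s', hs'⟩, hs⟩ := hs
          obtain ⟨-, h1, h2⟩ := hy i hi s' hs'
          have hmem := (hj i hi).1 s x hs
          rw [h1] at hmem
          exact (h2 s hmem).symm.trans (trunc_eq_of_trunc_succ_eq (ht i hi s x hs))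
        · exact trunc_eq_of_trunc_succ_eq (ht i hi s x hs))
      (by rw [Finset.card_erase_of_mem hyY]; omega)
    obtain ⟨v, hv, hvl⟩ := hρ i₁ (by simp [l'])
    -- The merged facts all take the valuation `v`, and `y` sits only on slot `s₀` of them, so its
    -- value can be read off there.
    refine ⟨Function.update ρ y (v s₀), fun i hi => ?_⟩
    by_cases hiy : ∃ s, i.label s y
    · obtain ⟨s', hs'⟩ := hiy
      refine ⟨v, ?_, fun s x hs => ?_⟩
      · rw [(hy i hi s' hs').2.1, ← hd₀.2.1]
        exact hv
      · by_cases hxy : x = y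
        · subst hxy
          rw [Function.update_self, (hy i hi s hs).1]
        · rw [Function.update_of_ne hxy]
          exact hvl s x ⟨hxy, i, hi, ⟨s', hs'⟩, hs⟩
    · obtain ⟨v', hv', hvl'⟩ := hρ i (List.mem_cons_of_mem _
        (List.mem_filter.2 ⟨hi, decide_eq_true hiy⟩))
      refine ⟨v', hv', fun s x hs => ?_⟩
      rw [Function.update_of_ne]
      · exact hvl' s x hs
      · rintro rfl
        exact hiy ⟨s, hs⟩
  -- Only database facts remain: their slots hold constants, and a term similar to a constant equals
  -- it.
  · refine ⟨t, fun i hi => ?_⟩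
    have hleaf : i.IsLeaf T D := (hj i hi).2.resolve_right fun ⟨r, τ, h⟩ => hex ⟨i, hi, r, τ, h⟩
    refine ⟨i.val, hleaf.2, fun s x hs => ?_⟩
    obtain ⟨c, hc⟩ := hleaf.1 s ((hj i hi).1 s x hs)
    have he := ht i hi s x hs
    obtain ⟨n, rfl⟩ : ∃ n', n = n' + 1 := ⟨n - 1, by omega⟩
    rw [hc] at he ⊢
    cases h : t x with
    | const d =>
      rw [h] at he
      simp only [trunc, const.injEq, Sum.inl.injEq] at he
      rw [he]
    | null r z f =>
      rw [h] at he
      simp [trunc] at he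

end Datalog

namespace Datalog

/-! ### The finite quotient -/

open ChaseElem

variable {σ : Signature.{u}} {C : Type v}

/-- If a query holds in the chase up to `trunc K n`, for large `K` and `n`, then it holds in the
chase. -/
lemma holdsAt_chase_of_approx [Nonempty C] {T : Set (TGD σ)} {D : Struct σ C} (hTfin : T.Finite)
    (hT : ∀ r ∈ T, r.IsJoinless) {K : ℕ} (φ : CQ σ) (Y : Finset ℕ) (hYK : Y.card ≤ K)
    (hφ : ∀ a ∈ φ, ∀ x ∈ a.argList, x ∈ Y) (t : ℕ → ChaseElem σ C)
    (h : ∀ a ∈ φ, ∃ f ∈ chase T D, f.map (trunc K K) = a.map fun x => trunc K K (t x)) :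
    ∃ ρ, (chase T D).HoldsAt φ ρ := by
  have hex : ∀ a : Atom σ Var, ∃ (c : Atom σ (Var × Var)) (i : LabelledFact σ C), a ∈ φ →
      c.map Prod.fst = i.pat ∧ c.map Prod.snd = a ∧ i.IsJustified T D ∧ i.Approx K K t ∧
      ∀ s x, i.label s x ↔ (s, x) ∈ c.argList := by
    intro a
    by_cases ha : a ∈ φ
    · obtain ⟨f, hf, hfa⟩ := h a ha
      obtain ⟨k, hk⟩ := Set.mem_iUnion.1 hf
      obtain ⟨pat, val, rfl, hj⟩ := LabelledFact.exists_of_mem_stage hk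
      obtain ⟨c, rfl, rfl, h3⟩ := Atom.exists_pair (a := pat) (f := trunc K K ∘ val) hfa
      refine ⟨c, ⟨_, val, k, fun s x => (s, x) ∈ c.argList⟩, fun _ => ⟨rfl, rfl, hj _ ?_,
        fun s x hs => h3 _ hs, fun _ _ => Iff.rfl⟩⟩
      intro s x hs
      rw [Atom.argList_map]
      exact List.mem_map_of_mem (f := Prod.fst) hs
    · exact ⟨a.map fun x => (x, x), ⟨a, t, 0, fun _ _ => True⟩, fun h => absurd h ha⟩
  choose c i hi using hex
  have hl : ∀ j ∈ φ.map i, ∃ a ∈ φ, i a = j := fun j hj => List.mem_map.1 hj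
  obtain ⟨ρ, hρ⟩ := exists_sat hTfin hT (D := D) (K := K) (n := K) t Y hYK hYK (φ.map i)
    (by
      intro j hj s x hs
      obtain ⟨a, ha, rfl⟩ := hl j hj
      obtain ⟨-, h2, -, -, h5⟩ := hi a ha
      refine hφ a ha x ?_
      rw [← h2, Atom.argList_map]
      exact List.mem_map_of_mem (f := Prod.snd) ((h5 s x).1 hs))
    (by
      intro j hj
      obtain ⟨a, ha, rfl⟩ := hl j hj
      exact (hi a ha).2.2.1)
    (by
      intro j hj
      obtain ⟨a, ha, rfl⟩ := hl j hj
      exact (hi a ha).2.2.2.1)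
  refine ⟨ρ, fun a ha => ?_⟩
  obtain ⟨v, hv, hvl⟩ := hρ _ (List.mem_map_of_mem ha)
  obtain ⟨h1, h2, -, -, h5⟩ := hi a ha
  have : (i a).pat.map v = a.map ρ := by
    rw [← h1]
    conv_rhs => rw [← h2]
    exact Atom.map_congr fun q hq => hvl _ _ ((h5 _ _).2 hq)
  rw [← this]
  exact hv

lemma Struct.finite_adom {D : Struct σ C} (hD : D.Finite) : D.adom.Finite :=
  (hD.biUnion fun f _ => f.argList.finite_toSet).subset fun _ ⟨_, hf, ha⟩ =>
    Set.mem_biUnion hf ha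

theorem finitelyControllable_of_mem_joinlessLogic {T : Set (TGD σ)} (hT : T ∈ JoinlessLogic σ) :
    FinitelyControllable.{u, v} T := by
  classical
  intro C _ D hD Ψ hΨ
  obtain ⟨hTfin, hTj⟩ := hT
  let Y : Finset ℕ := (Ψ.flatMap fun φ => φ.flatMap Atom.argList).toFinset
  -- The extra constant provides a default class even when `D` has no elements.
  let S : Set C := insert (Classical.arbitrary C) D.adom
  have hDS : D.adom ⊆ S := Set.subset_insert _ _
  let G : Set (ChaseElem σ C) := {t | t.Over T S}
  have hG₀ : const (Classical.arbitrary C) ∈ G := Set.mem_insert _ _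
  have hGD : ∀ c ∈ D.adom, const c ∈ G := fun c hc => hDS hc
  have hfin : (trunc Y.card Y.card '' G).Finite :=
    finite_trunc_image hTfin ((Struct.finite_adom hD).insert _) _ _
  obtain ⟨k, ⟨e⟩⟩ := hfin.exists_equiv_fin
  -- The quotient map by truncation; the junk value outside `G` is harmless, since chase facts only
  -- use terms from `G`.
  let H : ChaseElem σ C → Fin k := fun t =>
    if h : t ∈ G then e ⟨_, Set.mem_image_of_mem _ h⟩ else e ⟨_, Set.mem_image_of_mem _ hG₀⟩
  have hH : ∀ t (h : t ∈ G), H t = e ⟨_, Set.mem_image_of_mem _ h⟩ := fun t h => dif_pos h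
  have hHinj : ∀ s ∈ G, ∀ t ∈ G, H s = H t → trunc Y.card Y.card s = trunc Y.card Y.card t := by
    intro s hs t ht h
    rw [hH s hs, hH t ht, e.apply_eq_iff_eq] at h
    exact congrArg Subtype.val h
  have hHsurj : ∀ a, ∃ t ∈ G, H t = a := by
    intro a
    obtain ⟨⟨_, t, ht, rfl⟩, rfl⟩ := e.surjective a
    exact ⟨t, ht, hH t ht⟩
  have : Nonempty (ChaseElem σ C) := ⟨const (Classical.arbitrary C)⟩
  refine ⟨Fin k, inferInstance, Atom.map H '' chase T D, fun c => H (const c), ?_, ?_,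
    satTGDs_chase.image hTj H, ?_⟩
  · intro c hc d hd h
    have := hHinj _ (hGD c hc) _ (hGD d hd) h
    simpa [trunc] using this
  · exact fun f hf => ⟨f.map const, chaseStage_subset_chase 0 ⟨f, hf, rfl⟩, rfl⟩
  · rintro ⟨φ, hφ, τ, hτ⟩
    choose g hg hgH using hHsurj
    have hY : ∀ a ∈ φ, ∀ x ∈ a.argList, x ∈ Y := fun a ha x hx =>
      List.mem_toFinset.2 (List.mem_flatMap.2 ⟨φ, hφ, List.mem_flatMap.2 ⟨a, ha, hx⟩⟩)
    obtain ⟨ρ, hρ⟩ := holdsAt_chase_of_approx (T := T) (D := D) hTfin hTj φ Y le_rfl hY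
      (fun x => g (τ x)) (by
        intro a ha
        obtain ⟨f, hf, hfa⟩ := hτ a ha
        obtain ⟨c, rfl, rfl, hc⟩ := Atom.exists_pair hfa
        refine ⟨_, hf, ?_⟩
        rw [Atom.map_map, Atom.map_map]
        refine Atom.map_congr fun q hq => ?_
        refine hHinj _ (over_of_mem_chase hDS hf _ ?_) _ (hg _) ((hc q hq).trans (hgH _).symm)
        rw [Atom.argList_map]
        exact List.mem_map_of_mem hq)
    exact hΨ ⟨φ, hφ, ρ, hρ⟩

end Datalog

theorem theorem2 (σ : Datalog.Signature.{u}) (T : Set (Datalog.TGD σ))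
    (hT : T ∈ Datalog.JoinlessLogic σ) : Datalog.FinitelyControllable.{u, v} T :=
  Datalog.finitelyControllable_of_mem_joinlessLogic hT
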